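/- Let $\mathcal H$ be a separable complex Hilbert space and let $A$ be a self-adjoint operator in $\mathcal H$ with compact resolvent whose spectrum consists of simple eigenvalues $0<\mu_1<\mu_2<\cdots$, with normalized eigenvectors $A\psi_n=\mu_n\psi_n$, $\|\psi_n\|=1$, $n\in\mathbb N$. Let $a(f,g)=\langle A^{1/2}f,A^{1/2}g\rangle$, $\operatorname{Dom}(a)=\operatorname{Dom}(A^{1/2})$, write $a[f]=a(f,f)=\|A^{1/2}f\|^2$, and let $\mathcal D_a$ be $\operatorname{Dom}(a)$ with the norm $\|A^{1/2}\cdot\|$. Let $\omega_j\ge 0$, $j\in\mathbb N$, satisfy $\sum_{j}\omega_j^2/\mu_j<\infty$. (1) Let $v$ be a separately continuous sesquilinear form on $\mathcal D_a$ (i.e. all functionals $v(f,\cdot)$ and $v(\cdot,g)$, $f,g\in\mathcal D_a$, are continuous on $\mathcal D_a$) with $|v(\psi_j,\psi_k)|\le\omega_j\omega_k$ for all $j,k\in\mathbb N$. Write $v[f]=v(f,f)$. Then: - $v$ is bounded on $\mathcal D_a$, i.e. there is $C$ with $|v(f,g)|\le C\|A^{1/2}f\|\,\|A^{1/2}g\|$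 for all $f,g\in\mathcal D_a$; - for every $\varepsilon>0$ there is $C_\varepsilon>0$ such that $|v[f]|\le\varepsilon\,(a[f]+C_\varepsilon\|f\|^2)$ for all $f\in\mathcal D_a$, i.e. $v$ is form-bounded relative to $a$ with relative bound $0$; - the form $t=a+v$ with $\operatorname{Dom}(t)=\operatorname{Dom}(a)$ is closed and sectorial; - the operator $T$ associated with $t$, given by: $u\in\operatorname{Dom}(T)$ and $Tu=w$ if and only if $u\in\operatorname{Dom}(t)$ and $t(u,g)=\langle w,g\rangle$ for all $g\in\operatorname{Dom}(t)$, is well defined, m-sectorial, and has compact resolvent; it is the only m-sectorial operator with $\operatorname{Dom}(T)\subseteq\operatorname{Dom}(t)$ and $t(u,g)=\langle Tu,g\rangle$ for all $u\in\operatorname{Dom}(T)$, $g\in\operatorname{Dom}(t)$. (2) Every sesquilinear form $v_0$ on $\operatorname{span}\{\psi_k\}_{k\in\mathbb N}$ with $|v_0(\psi_j,\psi_k)|\le\omega_j\omega_k$ for all $j,k\in\mathbb N$, without any continuity assumption, extends to exactly one bounded sesquilinear form on $\mathcal D_a$ (to which (1) then applies). -/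

import Mathlib

open Filter Topology

noncomputable section

namespace FormPert

variable {H : Type*} [NormedAddCommGroup H] [InnerProductSpace ℂ H]

/-! ### Unbounded operators: resolvent, spectrum, compact resolvent, m-sectorial operators -/

/-- The bounded operator `R` is the resolvent `(z - T)⁻¹` of `T` at `z`. -/
def IsResolventAt (T : H →ₗ.[ℂ] H) (z : ℂ) (R : H →L[ℂ] H) : Prop :=
  (∀ x : H, ∃ y : T.domain, (y : H) = R x ∧ z • (y : H) - T y = x) ∧
    ∀ y : T.domain, R (z • (y : H) - T y) = y

/-- The resolvent set `ρ(T)`. -/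
def resolventSet (T : H →ₗ.[ℂ] H) : Set ℂ := {z | ∃ R : H →L[ℂ] H, IsResolventAt T z R}

/-- The spectrum `σ(T) = ℂ \ ρ(T)`. -/
def spectrum (T : H →ₗ.[ℂ] H) : Set ℂ := (resolventSet T)ᶜ

/-- `T` has compact resolvent: `ρ(T)` is non-empty and all `(z - T)⁻¹`, `z ∈ ρ(T)`, are compact. -/
def HasCompactResolvent (T : H →ₗ.[ℂ] H) : Prop :=
  (resolventSet T).Nonempty ∧
    ∀ (z : ℂ) (R : H →L[ℂ] H), IsResolventAt T z R → IsCompactOperator R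

/-- For `0 ≤ θ < π / 2` this is the closed sector `{ζ : |arg (ζ - γ)| ≤ θ}` with vertex `γ`
(the vertex belongs to it). -/
def sector (γ θ : ℝ) : Set ℂ := {ζ | γ ≤ ζ.re ∧ |ζ.im| ≤ Real.tan θ * (ζ.re - γ)}

/-- The numerical range of `T` lies in a sector of half-angle less than `π / 2`. -/
def IsSectorialOp (T : H →ₗ.[ℂ] H) : Prop :=
  ∃ γ θ : ℝ, 0 ≤ θ ∧ θ < Real.pi / 2 ∧
    ∀ u : T.domain, ‖(u : H)‖ = 1 → inner ℂ (u : H) (T u) ∈ sector γ θ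

/-- Some shift of `T` is m-accretive: for some real `α`, the half-plane `Re z < α` lies in `ρ(T)`
and `‖(z - T)⁻¹‖ ≤ 1 / (α - Re z)` there. -/
def IsQuasiMAccretive (T : H →ₗ.[ℂ] H) : Prop :=
  ∃ α : ℝ, ∀ z : ℂ, z.re < α →
    ∃ R : H →L[ℂ] H, IsResolventAt T z R ∧ ‖R‖ ≤ (α - z.re)⁻¹

/-- m-sectorial operators: sectorial and quasi-m-accretive. -/
def IsMSectorial (T : H →ₗ.[ℂ] H) : Prop := IsSectorialOp T ∧ IsQuasiMAccretive T

/-! ### Sesquilinear forms -/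

/-- Sesquilinear forms with domain `D ⊆ H`, linear in the first argument and antilinear in
the second one. -/
abbrev SesqForm (D : Submodule ℂ H) : Type _ := D →ₗ[ℂ] D →ₗ⋆[ℂ] ℂ

/-- The numerical range of the form `t` lies in a sector of half-angle less than `π / 2`. -/
def IsSectorialForm {D : Submodule ℂ H} (t : SesqForm D) : Prop :=
  ∃ γ θ : ℝ, 0 ≤ θ ∧ θ < Real.pi / 2 ∧ ∀ u : D, ‖(u : H)‖ = 1 → t u u ∈ sector γ θ

/-- The form `t` is closed: if `uₙ ∈ D`, `uₙ → u` in `H` and `t[uₙ - uₘ] → 0` as `n, m → ∞`,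
then `u ∈ D` and `t[uₙ - u] → 0`. -/
def IsClosedForm {D : Submodule ℂ H} (t : SesqForm D) : Prop :=
  ∀ (u : ℕ → D) (x : H), Tendsto (fun n => (u n : H)) atTop (𝓝 x) →
    Tendsto (fun p : ℕ × ℕ => t (u p.1 - u p.2) (u p.1 - u p.2)) atTop (𝓝 0) →
    ∃ y : D, (y : H) = x ∧ Tendsto (fun n => t (u n - y) (u n - y)) atTop (𝓝 0)

/-- `Dom T ⊆ D` and `t(u, g) = ⟨T u, g⟩` for all `u ∈ Dom T` and `g ∈ D`. -/
def Represents {D : Submodule ℂ H} (t : SesqForm D) (T : H →ₗ.[ℂ] H) : Prop :=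
  ∀ u : T.domain, ∃ hu : (u : H) ∈ D, ∀ g : D, t ⟨u, hu⟩ g = inner ℂ (g : H) (T u)

/-- `T` is the operator associated with the form `t`: `u ∈ Dom T` and `T u = w` if and only if
`u ∈ D` and `t(u, g) = ⟨w, g⟩` for all `g ∈ D`. -/
def IsAssociated {D : Submodule ℂ H} (t : SesqForm D) (T : H →ₗ.[ℂ] H) : Prop :=
  ∀ u w : H, (u, w) ∈ T.graph ↔
    ∃ hu : u ∈ D, ∀ g : D, t ⟨u, hu⟩ g = inner ℂ (g : H) w

/-- The form `v` is bounded with respect to the norm `‖S ·‖` on `Dom S`. -/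
def IsBoundedForm (S : H →ₗ.[ℂ] H) (v : SesqForm S.domain) : Prop :=
  ∃ C : ℝ, ∀ f g : S.domain, ‖v f g‖ ≤ C * ‖S f‖ * ‖S g‖

/-- The form `v` is separately continuous with respect to the norm `‖S ·‖` on `Dom S`: all the
functionals `v(f, ·)` and `v(·, g)` are bounded. -/
def IsSeparatelyContinuous (S : H →ₗ.[ℂ] H) (v : SesqForm S.domain) : Prop :=
  (∀ f : S.domain, ∃ C : ℝ, ∀ g : S.domain, ‖v f g‖ ≤ C * ‖S g‖) ∧
    ∀ g : S.domain, ∃ C : ℝ, ∀ f : S.domain, ‖v f g‖ ≤ C * ‖S f‖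

/-- The form `(f, g) ↦ ⟨S f, S g⟩` with domain `Dom S`. -/
def gramForm (S : H →ₗ.[ℂ] H) : SesqForm S.domain :=
  LinearMap.mk₂'ₛₗ (RingHom.id ℂ) (starRingEnd ℂ) (fun f g => inner ℂ (S g) (S f))
    (by intro f f' g; rw [S.map_add, inner_add_right])
    (by intro c f g; rw [S.map_smul, inner_smul_right]; rfl)
    (by intro f g g'; rw [S.map_add, inner_add_left])
    (by intro c f g; rw [S.map_smul, inner_smul_left]; rfl)

/-! ### Diagonal operators -/

/-- The (maximal) diagonal operator `f ↦ ∑ₙ dₙ ⟨f, ψₙ⟩ ψₙ`, with domain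
`{f ∈ H : ∑ₙ |dₙ ⟨f, ψₙ⟩|² < ∞}`. -/
def diagOp [CompleteSpace H] {ψ : ℕ → H} (hψ : Orthonormal ℂ ψ) (d : ℕ → ℝ) : H →ₗ.[ℂ] H where
  domain :=
    { carrier := {f | Memℓp (fun n => (d n : ℂ) * inner ℂ (ψ n) f) 2}
      zero_mem' := by
        refine cast (congrArg (fun s => Memℓp s 2) ?_)
          (zero_memℓp : Memℓp (0 : ℕ → ℂ) 2)
        funext n
        simp
      add_mem' := by
        intro f g hf hg
        have h := Memℓp.add hf hg
        refine cast (congrArg (fun s => Memℓp s 2) ?_) h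
        funext n
        simp [mul_add]
      smul_mem' := by
        intro c f hf
        have h := Memℓp.const_smul hf c
        refine cast (congrArg (fun s => Memℓp s 2) ?_) h
        funext n
        simp
        ring }
  toFun :=
    hψ.orthogonalFamily.linearIsometry.toLinearMap ∘ₗ
      { toFun := fun f => (⟨fun n => (d n : ℂ) * inner ℂ (ψ n) (f : H), f.2⟩ : lp (fun _ => ℂ) 2)
        map_add' := by
          intro f g
          ext n
          change _ = (_ : ℂ) * _ + (_ : ℂ) * _
          simp [mul_add]
        map_smul' := by
          intro c f
          ext n
          change _ = c * ((_ : ℂ) * _)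
          simp
          ring }

theorem mem_diagOp_domain [CompleteSpace H] {ψ : ℕ → H} (hψ : Orthonormal ℂ ψ) (d : ℕ → ℝ)
    (f : H) :
    f ∈ (diagOp hψ d).domain ↔ Summable fun n => ‖(d n : ℂ) * inner ℂ (ψ n) f‖ ^ 2 := by
  change Memℓp (fun n => (d n : ℂ) * inner ℂ (ψ n) f) 2 ↔ _
  rw [memℓp_gen_iff (by norm_num)]
  simp

theorem diagOp_apply [CompleteSpace H] {ψ : ℕ → H} (hψ : Orthonormal ℂ ψ) (d : ℕ → ℝ)
    (f : (diagOp hψ d).domain) :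
    HasSum (fun n => ((d n : ℂ) * inner ℂ (ψ n) (f : H)) • ψ n) (diagOp hψ d f) :=
  hψ.orthogonalFamily.hasSum_linearIsometry _

theorem basis_mem_diagOp_domain [CompleteSpace H] {ψ : ℕ → H} (hψ : Orthonormal ℂ ψ)
    (d : ℕ → ℝ) (j : ℕ) : ψ j ∈ (diagOp hψ d).domain := by
  rw [mem_diagOp_domain]
  refine summable_of_ne_finset_zero (s := {j}) fun n hn => ?_
  have h : inner ℂ (ψ n) (ψ j) = 0 := hψ.2 (by simpa using hn)
  simp [h]

/-! ### The unperturbed operator -/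

/-- `A` is a self-adjoint operator with compact resolvent, whose spectrum consists of the simple
eigenvalues `0 < μ 0 < μ 1 < ⋯`, and `ψ n` is a normalized eigenvector of `A` for `μ n`. -/
structure IsUnperturbed [CompleteSpace H] (A : H →ₗ.[ℂ] H) (μ : ℕ → ℝ) (ψ : ℕ → H) : Prop where
  selfAdjoint : IsSelfAdjoint A
  compactResolvent : HasCompactResolvent A
  spectrum_eq : spectrum A = Set.range fun n => (μ n : ℂ)
  pos : ∀ n, 0 < μ n
  strictMono : StrictMono μ
  eigen : ∀ n, ∃ x : A.domain, (x : H) = ψ n ∧ A x = (μ n : ℂ) • ψ n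
  simple : ∀ n, ∀ x : A.domain, A x = (μ n : ℂ) • (x : H) → ∃ c : ℂ, (x : H) = c • ψ n
  norm_eq_one : ∀ n, ‖ψ n‖ = 1

namespace IsUnperturbed

variable [CompleteSpace H] {A : H →ₗ.[ℂ] H} {μ : ℕ → ℝ} {ψ : ℕ → H}

theorem orthonormal (h : IsUnperturbed A μ ψ) : Orthonormal ℂ ψ := by
  refine ⟨h.norm_eq_one, fun m n hmn => ?_⟩
  obtain ⟨x, hx, hAx⟩ := h.eigen m
  obtain ⟨y, hy, hAy⟩ := h.eigen n
  have hs : A.adjoint.IsFormalAdjoint A :=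
    LinearPMap.adjoint_isFormalAdjoint h.selfAdjoint.dense_domain
  have hA : A.adjoint = A := h.selfAdjoint
  rw [hA] at hs
  have key := hs x y
  rw [hAx, hAy, hx, hy, inner_smul_left, inner_smul_right, Complex.conj_ofReal] at key
  have hne : (μ m : ℂ) - μ n ≠ 0 := by
    rw [sub_ne_zero]
    exact fun e => hmn (h.strictMono.injective (Complex.ofReal_injective e))
  have h0 : ((μ m : ℂ) - μ n) * inner ℂ (ψ m) (ψ n) = 0 := by rw [sub_mul, key, sub_self]
  exact (mul_eq_zero.mp h0).resolve_left hne

/-- The square root `A^{1/2}`, given by the functional calculus of `A`: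
`A^{1/2} f = ∑ₙ (μ n)^{1/2} ⟨f, ψ n⟩ ψ n`, with `f ∈ Dom A^{1/2}` iff `∑ₙ μ n |⟨f, ψ n⟩|² < ∞`. -/
def sqrtOp (h : IsUnperturbed A μ ψ) : H →ₗ.[ℂ] H := diagOp h.orthonormal fun n => √(μ n)

/-- The form `a(f, g) = ⟨A^{1/2} f, A^{1/2} g⟩` with `Dom a = Dom A^{1/2}`. -/
def form (h : IsUnperturbed A μ ψ) : SesqForm h.sqrtOp.domain := gramForm h.sqrtOp

/-- The eigenvector `ψ j` as an element of the form domain. -/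
def vec (h : IsUnperturbed A μ ψ) (j : ℕ) : h.sqrtOp.domain :=
  ⟨ψ j, basis_mem_diagOp_domain h.orthonormal _ j⟩

end IsUnperturbed

/-- The vector `ψ j` as an element of the linear span of all `ψ k`. -/
def spanVec (ψ : ℕ → H) (j : ℕ) : Submodule.span ℂ (Set.range ψ) :=
  ⟨ψ j, Submodule.subset_span (Set.mem_range_self j)⟩

end FormPert

end

/-! Write `S` for the square root of `A` and `f_j` for the coefficients of `f` in the eigenbasis.
Everything is governed by the functional `W(f) = ∑ ω_j |f_j|`. Since `ω_j |f_j| = (ω_j / √μ_j) ·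
√μ_j |f_j|`, Cauchy–Schwarz bounds `W(f)` by a multiple of `‖S f‖`. Splitting off finitely many
terms makes the multiple arbitrarily small at the price of a multiple of `‖f‖`
(`exists_tsum_weight_sq_le`). Separate continuity lets `v` be expanded in one argument at a time,
which gives `|v(f, g)| ≤ W(f) W(g)` (`norm_form_le`), hence boundedness and relative bound zero.
Conversely, the double series of a dominated matrix converges absolutely and obeys the same estimate
(`exists_isBoundedForm`), and a bounded form is determined by its matrix (`form_ext`).

The representation theorem is proved by hand with the bounded inverse `K` of `S`. Let `M` be the
bounded operator with `t(K x, K y) = ⟨M x, y⟩`, in the convention linear in the first slot. Formally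
`z - T = S N S` with `N = z K² - M`. For `Re z` far to the left, `N` is coercive, hence invertible,
and the resolvent is `K N⁻¹ K` (`exists_isResolventAt`). It is compact because `K` is, and `K` is
compact because `K² = A⁻¹` is. Uniqueness holds because an m-sectorial operator has no proper
m-sectorial restriction. -/

noncomputable section

namespace FormPert

variable {H : Type*} [NormedAddCommGroup H] [InnerProductSpace ℂ H]

/-! ### Resolvents -/

namespace IsResolventAt

variable {T : H →ₗ.[ℂ] H} {z z₀ : ℂ} {R R₀ : H →L[ℂ] H}

/-- The first resolvent identity. -/
theorem eq_comp (h : IsResolventAt T z R) (h₀ : IsResolventAt T z₀ R₀) :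
    R = R₀ ∘L (ContinuousLinearMap.id ℂ H + (z₀ - z) • R) := by
  ext x
  obtain ⟨y, hy, hyx⟩ := h.1 x
  have := h₀.2 y
  rw [← hy, ← this]
  simp only [ContinuousLinearMap.comp_apply, _root_.add_apply,
    ContinuousLinearMap.id_apply, _root_.smul_apply, ← hy]
  congr 1
  rw [← hyx]
  module

theorem hasCompactResolvent (h₀ : IsResolventAt T z₀ R₀) (hc : IsCompactOperator R₀) :
    HasCompactResolvent T := by
  refine ⟨⟨z₀, R₀, h₀⟩, fun z R h => ?_⟩
  rw [h.eq_comp h₀]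
  exact hc.comp_clm _

/-- An operator with a point in its resolvent set has no proper extension with that point in its
resolvent set. -/
theorem eq_of_le {T' : H →ₗ.[ℂ] H} {R' : H →L[ℂ] H} (h : IsResolventAt T z R)
    (h' : IsResolventAt T' z R') (hle : T' ≤ T) : T' = T := by
  refine LinearPMap.eq_of_le_of_domain_eq hle (le_antisymm hle.1 fun u hu => ?_)
  -- The smaller operator already attains the value `(z - T) u` at some `y` in its domain;
  -- injectivity of `z - T` then forces `y = u`.
  obtain ⟨y, hy, hyx⟩ := h'.1 (z • u - T ⟨u, hu⟩)
  have hTy : T' y = T ⟨y, hle.1 y.2⟩ := hle.2 rfl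
  have h1 := h.2 ⟨y, hle.1 y.2⟩
  have h2 := h.2 ⟨u, hu⟩
  simp only [← hTy] at h1
  rw [hyx] at h1
  rw [h1] at h2
  simp only at h2
  exact h2 ▸ y.2

/-- A lower bound of the numerical range gives a bound of the resolvent to the left of it. -/
theorem norm_le {α : ℝ} (h : IsResolventAt T z R)
    (hα : ∀ u : T.domain, α * ‖(u : H)‖ ^ 2 ≤ (inner ℂ (u : H) (T u)).re) (hz : z.re < α) :
    ‖R‖ ≤ (α - z.re)⁻¹ := by
  have hpos : 0 < α - z.re := sub_pos.2 hz
  refine R.opNorm_le_bound (inv_nonneg.2 hpos.le) fun x => ?_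
  obtain ⟨y, hy, hyx⟩ := h.1 x
  rw [← hy, inv_mul_eq_div, le_div_iff₀ hpos]
  have h1 : (α - z.re) * ‖(y : H)‖ ^ 2 ≤ ‖(y : H)‖ * ‖x‖ := by
    have h2 : (inner ℂ (y : H) x).re = z.re * ‖(y : H)‖ ^ 2 - (inner ℂ (y : H) (T y)).re := by
      rw [← hyx, inner_sub_right, inner_smul_right, inner_self_eq_norm_sq_to_K]
      simp [← Complex.ofReal_pow]
    have h3 : -(inner ℂ (y : H) x).re ≤ ‖(y : H)‖ * ‖x‖ :=
      (neg_le_abs _).trans ((Complex.abs_re_le_norm _).trans (norm_inner_le_norm _ _))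
    have := hα y
    linarith
  rcases (norm_nonneg (y : H)).eq_or_lt with h0 | h0
  · rw [← h0]; simp
  · nlinarith

end IsResolventAt

theorem IsMSectorial.eq_of_le {T T' : H →ₗ.[ℂ] H} (hT : IsMSectorial T) (hT' : IsMSectorial T')
    (hle : T' ≤ T) : T' = T := by
  obtain ⟨α, hα⟩ := hT.2
  obtain ⟨β, hβ⟩ := hT'.2
  -- A real point to the left of both half-plane bounds lies in both resolvent sets.
  have hz : (((min α β - 1 : ℝ) : ℂ)).re < min α β := by
    rw [Complex.ofReal_re]
    exact sub_one_lt _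
  obtain ⟨R, hR, -⟩ := hα _ (hz.trans_le (min_le_left _ _))
  obtain ⟨R', hR', -⟩ := hβ _ (hz.trans_le (min_le_right _ _))
  exact hR.eq_of_le hR' hle

/-! ### Compactness of a square root -/

/-- A symmetric operator with compact square is compact. -/
theorem isCompactOperator_of_comp_self [CompleteSpace H] {K : H →L[ℂ] H}
    (hK : (K : H →ₗ[ℂ] H).IsSymmetric) (hc : IsCompactOperator (⇑K ∘ ⇑K : H → H)) :
    IsCompactOperator (⇑K : H → H) := by
  have hc' := (isCompactOperator_iff_isCompact_closure_image_ball (𝕜₁ := ℂ) (𝕜₂ := ℂ)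
    (r := 1) ((K : H →ₗ[ℂ] H) ∘ₗ (K : H →ₗ[ℂ] H)) one_pos).1 hc
  refine (isCompactOperator_iff_isCompact_closure_image_ball (𝕜₁ := ℂ) (𝕜₂ := ℂ) (r := 1)
    (K : H →ₗ[ℂ] H) one_pos).2 ?_
  have htb := hc'.totallyBounded.subset subset_closure
  suffices htK : TotallyBounded ((K : H → H) '' Metric.ball 0 1) from
    htK.closure.isCompact_of_isClosed isClosed_closure
  rw [Metric.totallyBounded_iff]
  intro ε hε
  -- Symmetry gives `‖K d‖² ≤ ‖d‖ ‖K² d‖`, and `‖d‖ ≤ 2` for differences of points of the unit ball.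
  -- So an `ε² / 2`-net for the image under `K²` yields an `ε`-net for the image under `K`.
  obtain ⟨t, hts, htf, ht⟩ := Metric.finite_approx_of_totallyBounded htb (ε ^ 2 / 2)
    (by positivity)
  have hts' : ∀ y ∈ t, ∃ x ∈ Metric.ball (0 : H) 1, K (K x) = y := fun y hy => hts hy
  choose! s hsB hs using hts'
  refine ⟨(fun y => K (s y)) '' t, htf.image _, ?_⟩
  rintro _ ⟨x, hx, rfl⟩
  obtain ⟨y, hy, hxy⟩ := Set.mem_iUnion₂.1 (ht ⟨x, hx, rfl⟩)
  refine Set.mem_iUnion₂.2 ⟨_, Set.mem_image_of_mem _ hy, ?_⟩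
  rw [Metric.mem_ball, ← hs y hy, dist_eq_norm] at hxy
  rw [Metric.mem_ball, dist_eq_norm]
  change ‖K x - K (s y)‖ < ε
  rw [← map_sub]
  have h1 : ‖K (x - s y)‖ ^ 2 ≤ ‖x - s y‖ * ‖K (K (x - s y))‖ := by
    have h2 : inner ℂ (K (x - s y)) (K (x - s y)) = inner ℂ (x - s y) (K (K (x - s y))) :=
      hK _ _
    have h3 := norm_inner_le_norm (𝕜 := ℂ) (x - s y) (K (K (x - s y)))
    rw [← h2, inner_self_eq_norm_sq_to_K] at h3
    simpa using h3
  have h2 : ‖x - s y‖ ≤ 2 := by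
    have h3 := norm_sub_le x (s y)
    have h4 := mem_ball_zero_iff.1 hx
    have h5 := mem_ball_zero_iff.1 (hsB y hy)
    linarith
  have h3 : ‖K (K (x - s y))‖ < ε ^ 2 / 2 := by
    rw [map_sub, map_sub]
    exact hxy
  refine lt_of_pow_lt_pow_left₀ 2 hε.le ?_
  nlinarith [norm_nonneg (K (K (x - s y)))]

/-! ### Operators with a bounded symmetric inverse -/

/-- `K` is a bounded symmetric inverse of `S`. -/
structure IsSymmInverse (S : H →ₗ.[ℂ] H) (K : H →L[ℂ] H) : Prop where
  mem_domain : ∀ x, K x ∈ S.domain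
  apply_inv : ∀ x, S ⟨K x, mem_domain x⟩ = x
  inv_apply : ∀ f : S.domain, K (S f) = f
  symm : (K : H →ₗ[ℂ] H).IsSymmetric

namespace IsSymmInverse

variable {S : H →ₗ.[ℂ] H} {K : H →L[ℂ] H}

theorem injective (h : IsSymmInverse S K) : Function.Injective K := fun x y hxy => by
  rw [← h.apply_inv x, ← h.apply_inv y]
  congr 1
  exact Subtype.ext hxy

/-- The inverse as a linear map into the domain. -/
def toDomain (h : IsSymmInverse S K) : H →ₗ[ℂ] S.domain :=
  (K : H →ₗ[ℂ] H).codRestrict S.domain h.mem_domain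

@[simp] theorem coe_toDomain (h : IsSymmInverse S K) (x : H) : (h.toDomain x : H) = K x := rfl

@[simp] theorem apply_toDomain (h : IsSymmInverse S K) (x : H) : S (h.toDomain x) = x :=
  h.apply_inv x

@[simp] theorem toDomain_apply (h : IsSymmInverse S K) (f : S.domain) : h.toDomain (S f) = f :=
  Subtype.ext (h.inv_apply f)

/-- Testing with `K (K w)` gives `‖K w‖² = 0`. This is the density of the form domain, which makes
the associated operator single-valued. -/
theorem eq_zero_of_inner_domain (h : IsSymmInverse S K) {w : H}
    (hw : ∀ g : S.domain, inner ℂ (g : H) w = 0) : w = 0 := by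
  refine h.injective ?_
  rw [map_zero, ← inner_self_eq_zero (𝕜 := ℂ)]
  have h1 := hw (h.toDomain (K w))
  rw [h.coe_toDomain] at h1
  exact (h.symm (K w) w).symm.trans h1

/-- A bounded form on the domain of `S` is given by a bounded operator. -/
theorem exists_formOp [CompleteSpace H] (h : IsSymmInverse S K) {t : SesqForm S.domain}
    (ht : IsBoundedForm S t) :
    ∃ M : H →L[ℂ] H, ∀ x (g : S.domain), t (h.toDomain x) g = inner ℂ (S g) (M x) := by
  obtain ⟨C, hC⟩ := ht
  -- Conjugation moves the antilinearity to the first slot, as the Riesz representation of bounded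
  -- forms requires.
  let b : H →ₗ⋆[ℂ] H →ₗ[ℂ] ℂ := LinearMap.mk₂'ₛₗ (starRingEnd ℂ) (RingHom.id ℂ)
    (fun x y => starRingEnd ℂ (t (h.toDomain x) (h.toDomain y)))
    (by intro x x' y; simp) (by intro c x y; simp) (by intro x y y'; simp)
    (by intro c x y; simp)
  let b' := b.mkContinuous₂ C (fun x y => by simpa [b] using hC (h.toDomain x) (h.toDomain y))
  refine ⟨InnerProductSpace.continuousLinearMapOfBilin b', fun x g => ?_⟩
  rw [← inner_conj_symm, InnerProductSpace.continuousLinearMapOfBilin_apply]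
  simp [b', b]

end IsSymmInverse

/-! ### The operator associated with a form -/

/-- The graph of the operator associated with a form. -/
def formGraph {D : Submodule ℂ H} (t : SesqForm D) : Submodule ℂ (H × H) where
  carrier := {p | ∃ hu : p.1 ∈ D, ∀ g : D, t ⟨p.1, hu⟩ g = inner ℂ (g : H) p.2}
  zero_mem' := by
    refine ⟨D.zero_mem, fun g => ?_⟩
    have : (⟨(0 : H × H).1, D.zero_mem⟩ : D) = 0 := rfl
    rw [this]; simp
  add_mem' := by
    rintro p q ⟨hp, hp'⟩ ⟨hq, hq'⟩
    refine ⟨D.add_mem hp hq, fun g => ?_⟩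
    have : (⟨(p + q).1, D.add_mem hp hq⟩ : D) = ⟨p.1, hp⟩ + ⟨q.1, hq⟩ := rfl
    rw [this, map_add, LinearMap.add_apply, hp', hq', Prod.snd_add, inner_add_right]
  smul_mem' := by
    rintro c p ⟨hp, hp'⟩
    refine ⟨D.smul_mem c hp, fun g => ?_⟩
    have : (⟨(c • p).1, D.smul_mem c hp⟩ : D) = c • ⟨p.1, hp⟩ := rfl
    rw [this, map_smul, LinearMap.smul_apply, hp', Prod.smul_snd, inner_smul_right, smul_eq_mul]

/-- The operator associated with a form. -/
def formOperator {D : Submodule ℂ H} (t : SesqForm D) : H →ₗ.[ℂ] H := (formGraph t).toLinearPMap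

namespace IsAssociated

variable {D : Submodule ℂ H} {t : SesqForm D} {T : H →ₗ.[ℂ] H}

theorem represents (h : IsAssociated t T) : Represents t T := fun u =>
  (h u (T u)).1 (T.mem_graph u)

theorem le_of_represents (h : IsAssociated t T) {T' : H →ₗ.[ℂ] H} (h' : Represents t T') :
    T' ≤ T := by
  refine LinearPMap.le_of_le_graph ?_
  rintro ⟨u, w⟩ hu
  obtain ⟨y, rfl, rfl⟩ := T'.mem_graph_iff.1 hu
  exact (h _ _).2 (h' y)

end IsAssociated

theorem isAssociated_formOperator {S : H →ₗ.[ℂ] H} {K : H →L[ℂ] H} (h : IsSymmInverse S K)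
    (t : SesqForm S.domain) : IsAssociated t (formOperator t) := by
  intro u w
  rw [formOperator, Submodule.toLinearPMap_graph_eq]
  · rfl
  · rintro ⟨u, w⟩ ⟨hu, hw⟩ rfl
    refine h.eq_zero_of_inner_domain fun g => ?_
    rw [← hw g]
    have : (⟨0, hu⟩ : S.domain) = 0 := rfl
    rw [this]; simp

/-! ### Closed sectorial forms -/

section FormBound

variable {S : H →ₗ.[ℂ] H} {K : H →L[ℂ] H} {v : SesqForm S.domain} {C : ℝ}

theorem gramForm_self (f : S.domain) : gramForm S f f = ((‖S f‖ ^ 2 : ℝ) : ℂ) := by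
  change inner ℂ (S f) (S f) = _
  rw [inner_self_eq_norm_sq_to_K]
  simp

theorem isBoundedForm_gramForm_add (hv : IsBoundedForm S v) : IsBoundedForm S (gramForm S + v) := by
  obtain ⟨B, hB⟩ := hv
  refine ⟨1 + B, fun f g => ?_⟩
  have h1 : ‖gramForm S f g‖ ≤ ‖S g‖ * ‖S f‖ := norm_inner_le_norm _ _
  have h2 := norm_add_le (gramForm S f g) (v f g)
  rw [LinearMap.add_apply, LinearMap.add_apply]
  linarith [hB f g]

/-- Coercivity: a relative bound `1 / 2` leaves half of `‖S f‖²`. Closedness, the sector and the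
resolvent estimates all rest on this. -/
theorem le_re_gramForm_add
    (hC : ∀ f : S.domain, ‖v f f‖ ≤ 1 / 2 * (‖S f‖ ^ 2 + C * ‖(f : H)‖ ^ 2)) (f : S.domain) :
    1 / 2 * ‖S f‖ ^ 2 - C * ‖(f : H)‖ ^ 2 / 2 ≤ ((gramForm S + v) f f).re := by
  rw [LinearMap.add_apply, LinearMap.add_apply, gramForm_self, Complex.add_re, Complex.ofReal_re]
  have := (neg_le_abs _).trans ((Complex.abs_re_le_norm (v f f)).trans (hC f))
  linarith

/-- With vertex `-C`, the shifted real part is at least `(‖S f‖² + C) / 2`, which is also the bound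
for the imaginary part; hence slope 1 suffices. -/
theorem mem_sector_gramForm_add
    (hC : ∀ f : S.domain, ‖v f f‖ ≤ 1 / 2 * (‖S f‖ ^ 2 + C * ‖(f : H)‖ ^ 2)) (f : S.domain)
    (hf : ‖(f : H)‖ = 1) (hC0 : 0 ≤ C) : (gramForm S + v) f f ∈ sector (-C) (Real.pi / 4) := by
  have h1 := le_re_gramForm_add hC f
  have h2 : |((gramForm S + v) f f).im| ≤ 1 / 2 * (‖S f‖ ^ 2 + C * ‖(f : H)‖ ^ 2) := by
    rw [LinearMap.add_apply, LinearMap.add_apply, gramForm_self, Complex.add_im,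
      Complex.ofReal_im, zero_add]
    exact (Complex.abs_im_le_norm (v f f)).trans (hC f)
  rw [hf] at h1 h2
  refine ⟨?_, ?_⟩
  · nlinarith [sq_nonneg ‖S f‖]
  · rw [Real.tan_pi_div_four]
    linarith

theorem isSectorialForm_gramForm_add (hC0 : 0 ≤ C)
    (hC : ∀ f : S.domain, ‖v f f‖ ≤ 1 / 2 * (‖S f‖ ^ 2 + C * ‖(f : H)‖ ^ 2)) :
    IsSectorialForm (gramForm S + v) :=
  ⟨-C, Real.pi / 4, by positivity, by linarith [Real.pi_pos],
    fun f hf => mem_sector_gramForm_add hC f hf hC0⟩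

/-- By coercivity `‖S (uₙ - uₘ)‖² ≤ 2 |t[uₙ - uₘ]| + C ‖uₙ - uₘ‖²`, so `S uₙ` converges to some `y`.
The limit of `uₙ = K (S uₙ)` is then `K y`, and boundedness of the form gives convergence in the
form sense. -/
theorem isClosedForm_gramForm_add [CompleteSpace H] (h : IsSymmInverse S K)
    (hv : IsBoundedForm S v)
    (hC : ∀ f : S.domain, ‖v f f‖ ≤ 1 / 2 * (‖S f‖ ^ 2 + C * ‖(f : H)‖ ^ 2)) :
    IsClosedForm (gramForm S + v) := by
  intro u x hux htu
  have hS : Tendsto (fun p : ℕ × ℕ => ‖S (u p.1) - S (u p.2)‖ ^ 2) atTop (𝓝 0) := by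
    have hd : Tendsto (fun p : ℕ × ℕ => ‖(u p.1 : H) - u p.2‖ ^ 2) atTop (𝓝 0) := by
      have h1 : Tendsto (fun p : ℕ × ℕ => (u p.1 : H) - u p.2) atTop (𝓝 (x - x)) := by
        rw [← prod_atTop_atTop_eq]
        exact (hux.comp tendsto_fst).sub (hux.comp tendsto_snd)
      simpa using (h1.norm.pow 2)
    have h2 := (htu.norm.const_mul 2).add (hd.const_mul C)
    simp only [norm_zero, mul_zero, add_zero] at h2
    refine squeeze_zero (fun _ => by positivity) (fun p => ?_) h2
    have h3 := le_re_gramForm_add hC (u p.1 - u p.2)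
    have h4 := (le_abs_self _).trans
      (Complex.abs_re_le_norm ((gramForm S + v) (u p.1 - u p.2) (u p.1 - u p.2)))
    rw [S.map_sub, Submodule.coe_sub] at h3
    linarith
  have hcau : CauchySeq fun n => S (u n) := by
    rw [cauchySeq_iff_tendsto_dist_atTop_0]
    have := hS.sqrt
    simpa [Real.sqrt_sq, dist_eq_norm] using this
  obtain ⟨y, hy⟩ := cauchySeq_tendsto_of_complete hcau
  refine ⟨h.toDomain y, ?_, ?_⟩
  · refine tendsto_nhds_unique ?_ hux
    have := (K.continuous.tendsto y).comp hy
    simpa [Function.comp_def, h.inv_apply] using this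
  · obtain ⟨B, hB⟩ := isBoundedForm_gramForm_add hv
    have h1 : Tendsto (fun n => B * ‖S (u n) - y‖ * ‖S (u n) - y‖) atTop (𝓝 0) := by
      have h2 : Tendsto (fun n => ‖S (u n) - y‖) atTop (𝓝 0) :=
        tendsto_iff_norm_sub_tendsto_zero.1 hy
      simpa using (h2.const_mul B).mul h2
    refine squeeze_zero_norm (fun n => ?_) h1
    have := hB (u n - h.toDomain y) (u n - h.toDomain y)
    rwa [S.map_sub, h.apply_toDomain] at this

/-- The resolvent of the operator associated with `a + v` factors through the inverse of `S`. -/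
theorem exists_isResolventAt [CompleteSpace H] (h : IsSymmInverse S K)
    (hv : IsBoundedForm S v)
    (hC : ∀ f : S.domain, ‖v f f‖ ≤ 1 / 2 * (‖S f‖ ^ 2 + C * ‖(f : H)‖ ^ 2))
    {T : H →ₗ.[ℂ] H} (hT : IsAssociated (gramForm S + v) T) {z : ℂ} (hz : z.re < -(C / 2)) :
    ∃ G : H →L[ℂ] H, IsResolventAt T z (K ∘L G) := by
  obtain ⟨M, hM⟩ := h.exists_formOp (isBoundedForm_gramForm_add hv)
  have hK : ∀ x y, inner ℂ (K x) y = inner ℂ x (K y) := h.symm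
  set N : H →L[ℂ] H := z • (K ∘L K) - M with hN
  have hunit : IsUnit N := by
    -- Lax–Milgram: since `Re z < -C / 2`, the term `z ‖K x‖²` absorbs the negative part of the
    -- lower bound, and `Re ⟨x, N x⟩ ≤ -‖x‖² / 2`.
    refine N.isUnit_of_forall_le_norm_inner_map (c := 1 / 2) (by norm_num) fun x => ?_
    have h1 : inner ℂ x (N x) = z * ((‖K x‖ ^ 2 : ℝ) : ℂ)
        - (gramForm S + v) (h.toDomain x) (h.toDomain x) := by
      rw [hM, h.apply_toDomain, hN]
      simp only [_root_.sub_apply, _root_.smul_apply,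
        ContinuousLinearMap.comp_apply, inner_sub_right, inner_smul_right]
      rw [← hK, inner_self_eq_norm_sq_to_K]
      simp
    have h2 := le_re_gramForm_add hC (h.toDomain x)
    rw [h.apply_toDomain, h.coe_toDomain] at h2
    have h3 := congrArg Complex.re h1
    rw [Complex.sub_re, Complex.re_mul_ofReal] at h3
    have h4 := (neg_le_abs _).trans (Complex.abs_re_le_norm (inner ℂ x (N x)))
    rw [← norm_inner_symm] at h4
    have h5 : z.re * ‖K x‖ ^ 2 ≤ -(C / 2) * ‖K x‖ ^ 2 := by gcongr
    push_cast
    linarith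
  obtain ⟨N', hN1⟩ := hunit.exists_right_inv
  have hN2 : N' * N = 1 := by
    obtain ⟨U, hU⟩ := hunit
    rw [← hU, Units.mul_eq_one_iff_inv_eq] at hN1
    rw [← hN1, ← hU, Units.inv_mul]
  -- In these coordinates `T` is `K⁻¹ M K⁻¹`, so `(z - T) (K x) = w` amounts to `N x = K w`.
  have hgraph : ∀ x w, (K x, w) ∈ T.graph ↔ M x = K w := by
    intro x w
    rw [hT]
    constructor
    · rintro ⟨hu, hw⟩
      refine ext_inner_left ℂ fun y => ?_
      have h1 := hw (h.toDomain y)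
      rw [← hK]
      have h2 := hM x (h.toDomain y)
      rw [h.apply_toDomain] at h2
      exact h2.symm.trans h1
    · intro hx
      refine ⟨h.mem_domain x, fun g => ?_⟩
      have h2 := hM x g
      rw [hx, ← hK, h.inv_apply] at h2
      exact h2
  refine ⟨N' ∘L K, fun x => ?_, fun y => ?_⟩
  · have h1 : N (N' (K x)) = K x := DFunLike.congr_fun hN1 (K x)
    have h2 : (K (N' (K x)), z • K (N' (K x)) - x) ∈ T.graph := by
      rw [hgraph, map_sub, map_smul]
      have h2 : z • K (K (N' (K x))) - M (N' (K x)) = K x := h1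
      rw [eq_sub_iff_add_eq, ← eq_sub_iff_add_eq', h2]
    obtain ⟨y, hy, hTy⟩ := T.mem_graph_iff.1 h2
    refine ⟨y, hy, ?_⟩
    simp only at hy hTy
    rw [hTy, hy]
    abel
  · have h0 := T.mem_graph y
    obtain ⟨hy, -⟩ := hT.represents y
    have hyK : (y : H) = K (S ⟨y, hy⟩) := (h.inv_apply ⟨y, hy⟩).symm
    generalize S ⟨y, hy⟩ = x at hyK
    rw [hyK, hgraph] at h0
    have h1 : K (z • (y : H) - T y) = N x := by
      rw [map_sub, ← h0, map_smul, hyK, hN]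
      simp
    change K (N' (K _)) = _
    rw [h1, hyK]
    exact congrArg K (DFunLike.congr_fun hN2 x)

/-- The first representation theorem for a relatively small perturbation of a form with compact
inverse. -/
theorem exists_isAssociated_isMSectorial [CompleteSpace H] (h : IsSymmInverse S K)
    (hKc : IsCompactOperator (⇑K : H → H)) (hv : IsBoundedForm S v) (hC0 : 0 ≤ C)
    (hC : ∀ f : S.domain, ‖v f f‖ ≤ 1 / 2 * (‖S f‖ ^ 2 + C * ‖(f : H)‖ ^ 2)) :
    ∃ T : H →ₗ.[ℂ] H, IsAssociated (gramForm S + v) T ∧ IsMSectorial T ∧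
      HasCompactResolvent T ∧
      ∀ T' : H →ₗ.[ℂ] H, IsMSectorial T' → Represents (gramForm S + v) T' → T' = T := by
  have hT := isAssociated_formOperator h (gramForm S + v)
  set T := formOperator (gramForm S + v)
  have hms : IsMSectorial T := by
    refine ⟨⟨-C, Real.pi / 4, by positivity, by linarith [Real.pi_pos], fun u hu => ?_⟩,
      -(C / 2), fun z hz => ?_⟩
    · obtain ⟨hu', hg⟩ := hT.represents u
      rw [← hg ⟨u, hu'⟩]
      exact mem_sector_gramForm_add hC ⟨u, hu'⟩ hu hC0
    · obtain ⟨G, hG⟩ := exists_isResolventAt h hv hC hT hz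
      refine ⟨_, hG, hG.norm_le (fun u => ?_) hz⟩
      obtain ⟨hu', hg⟩ := hT.represents u
      rw [← hg ⟨u, hu'⟩]
      have := le_re_gramForm_add hC ⟨u, hu'⟩
      nlinarith [sq_nonneg ‖S ⟨u, hu'⟩‖]
  refine ⟨T, hT, hms, ?_, fun T' hT' hr => hms.eq_of_le hT' (hT.le_of_represents hr)⟩
  obtain ⟨G, hG⟩ := exists_isResolventAt h hv hC hT
    (z := ((-(C / 2) - 1 : ℝ) : ℂ)) (by rw [Complex.ofReal_re]; linarith)
  exact hG.hasCompactResolvent (hKc.comp_clm G)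

end FormBound

/-! ### Spectral facts on the unperturbed operator -/

theorem inner_diagOp [CompleteSpace H] {ψ : ℕ → H} (hψ : Orthonormal ℂ ψ) (d : ℕ → ℝ) (n : ℕ)
    (f : (diagOp hψ d).domain) :
    inner ℂ (ψ n) (diagOp hψ d f) = (d n : ℂ) * inner ℂ (ψ n) (f : H) := by
  have h1 := (diagOp_apply hψ d f).mapL (innerSL ℂ (ψ n))
  refine h1.unique ?_
  convert hasSum_single n ?_ using 1
  · simp [inner_self_eq_norm_sq_to_K, hψ.1 n]
  · intro m hm
    have : inner ℂ (ψ n) (ψ m) = 0 := hψ.2 hm.symm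
    simp [this]

namespace IsUnperturbed

variable [CompleteSpace H] {A : H →ₗ.[ℂ] H} {μ : ℕ → ℝ} {ψ : ℕ → H}

theorem inner_apply_left (h : IsUnperturbed A μ ψ) (x y : A.domain) :
    inner ℂ (A x) (y : H) = inner ℂ (x : H) (A y) := by
  have hs : A.adjoint.IsFormalAdjoint A :=
    LinearPMap.adjoint_isFormalAdjoint h.selfAdjoint.dense_domain
  have hA : A.adjoint = A := h.selfAdjoint
  rw [hA] at hs
  exact hs x y

theorem inner_apply (h : IsUnperturbed A μ ψ) (n : ℕ) (y : A.domain) :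
    inner ℂ (ψ n) (A y) = (μ n : ℂ) * inner ℂ (ψ n) (y : H) := by
  obtain ⟨x, hx, hAx⟩ := h.eigen n
  rw [← hx, ← h.inner_apply_left, hAx, inner_smul_left, Complex.conj_ofReal, hx]

theorem exists_isResolventAt_zero (h : IsUnperturbed A μ ψ) :
    ∃ G : H →L[ℂ] H, IsResolventAt A 0 G := by
  have h0 : (0 : ℂ) ∉ spectrum A := by
    rw [h.spectrum_eq]
    rintro ⟨n, hn⟩
    exact (h.pos n).ne' (Complex.ofReal_eq_zero.1 hn)
  rwa [spectrum, Set.notMem_compl_iff] at h0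

/-- The resolvent at 0 is compact and symmetric, so its eigenspaces are total. A nonzero eigenvector
with eigenvalue `c` is an eigenvector of `A` for `-c⁻¹`; this number is some `μ n`, and simplicity
puts the vector on the line of `ψ n`. -/
theorem orthogonal_span_eq_bot (h : IsUnperturbed A μ ψ) :
    (Submodule.span ℂ (Set.range ψ))ᗮ = ⊥ := by
  obtain ⟨G, hG⟩ := h.exists_isResolventAt_zero
  have hA : ∀ x, ∃ y : A.domain, (y : H) = G x ∧ A y = -x := fun x => by
    obtain ⟨y, hy, hx⟩ := hG.1 x
    exact ⟨y, hy, by rw [← hx]; simp⟩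
  have hsymm : (G : H →ₗ[ℂ] H).IsSymmetric := fun x x' => by
    obtain ⟨y, hy, hx⟩ := hA x
    obtain ⟨y', hy', hx'⟩ := hA x'
    have := h.inner_apply_left y y'
    rw [hx, hx', inner_neg_left, inner_neg_right, neg_inj, hy, hy'] at this
    exact this.symm
  have key := ContinuousLinearMap.orthogonalComplement_iSup_eigenspaces_eq_bot
    (h.compactResolvent.2 0 G hG) hsymm
  rw [eq_bot_iff, ← key]
  refine Submodule.orthogonal_le (iSup_le fun c x hx => ?_)
  rw [Module.End.mem_eigenspace_iff] at hx
  change G x = c • x at hx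
  obtain ⟨y, hy, hAy⟩ := hA x
  by_cases hy0 : y = 0
  · rw [hy0, LinearPMap.map_zero, zero_eq_neg] at hAy
    rw [hAy]
    exact Submodule.zero_mem _
  have hc : c ≠ 0 := by
    rintro rfl
    rw [hx, zero_smul] at hy
    exact hy0 (Subtype.ext hy)
  have hxy : x = c⁻¹ • (y : H) := by rw [hy, hx, inv_smul_smul₀ hc]
  have hν : -c⁻¹ ∈ spectrum A := by
    rintro ⟨R, hR⟩
    have h1 := hR.2 y
    rw [hAy, neg_smul, ← hxy, sub_neg_eq_add, neg_add_cancel, map_zero] at h1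
    exact hy0 (Subtype.ext h1.symm)
  rw [h.spectrum_eq] at hν
  obtain ⟨n, hn⟩ := hν
  obtain ⟨a, ha⟩ := h.simple n y (by simp only at hn; rw [hAy, hn, neg_smul, ← hxy])
  rw [hxy, ha]
  exact Submodule.smul_mem _ _ (Submodule.smul_mem _ _ (Submodule.subset_span ⟨n, rfl⟩))

/-- The eigenvectors form a Hilbert basis. -/
def basis (h : IsUnperturbed A μ ψ) : HilbertBasis ℕ ℂ H :=
  HilbertBasis.mkOfOrthogonalEqBot h.orthonormal h.orthogonal_span_eq_bot

theorem coe_basis (h : IsUnperturbed A μ ψ) : ⇑h.basis = ψ :=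
  HilbertBasis.coe_mkOfOrthogonalEqBot _ _

theorem ext_inner (h : IsUnperturbed A μ ψ) {x y : H}
    (hxy : ∀ n, inner ℂ (ψ n) x = inner ℂ (ψ n) y) : x = y := by
  refine h.basis.repr.injective (lp.ext (funext fun n => ?_))
  rw [HilbertBasis.repr_apply_apply, HilbertBasis.repr_apply_apply, h.coe_basis, hxy]

theorem inner_sqrtOp (h : IsUnperturbed A μ ψ) (n : ℕ) (f : h.sqrtOp.domain) :
    inner ℂ (ψ n) (h.sqrtOp f) = (√(μ n) : ℂ) * inner ℂ (ψ n) (f : H) :=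
  inner_diagOp _ _ n f

theorem sqrt_ne_zero (h : IsUnperturbed A μ ψ) (n : ℕ) : (√(μ n) : ℂ) ≠ 0 :=
  Complex.ofReal_ne_zero.2 (Real.sqrt_ne_zero'.2 (h.pos n))

theorem sqrtOp_injective (h : IsUnperturbed A μ ψ) : Function.Injective h.sqrtOp := fun f g hfg => by
  refine Subtype.ext (h.ext_inner fun n => mul_left_cancel₀ (h.sqrt_ne_zero n) ?_)
  rw [← h.inner_sqrtOp, hfg, h.inner_sqrtOp]

theorem inner_sqrtOp_left (h : IsUnperturbed A μ ψ) (f g : h.sqrtOp.domain) :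
    inner ℂ (h.sqrtOp f) (g : H) = inner ℂ (f : H) (h.sqrtOp g) := by
  rw [← h.basis.tsum_inner_mul_inner, ← h.basis.tsum_inner_mul_inner]
  refine tsum_congr fun n => ?_
  rw [h.coe_basis, h.inner_sqrtOp, ← inner_conj_symm, h.inner_sqrtOp, map_mul, inner_conj_symm,
    Complex.conj_ofReal]
  ring

/-- Divide the coefficients by `√(μ n)`; they stay square summable because `μ n ≥ μ 0 > 0`. -/
theorem sqrtOp_surjective (h : IsUnperturbed A μ ψ) : Function.Surjective h.sqrtOp := fun x => by
  have hx := h.orthonormal.inner_products_summable x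
  have hc : Memℓp (fun n => (√(μ n) : ℂ)⁻¹ * inner ℂ (ψ n) x) 2 := by
    rw [memℓp_gen_iff (by norm_num)]
    refine (hx.mul_left (μ 0)⁻¹).of_nonneg_of_le (fun n => by positivity) fun n => ?_
    simp only [norm_mul, norm_inv, Complex.norm_real, Real.norm_eq_abs,
      abs_of_nonneg (Real.sqrt_nonneg _), ENNReal.toReal_ofNat, Real.rpow_ofNat, mul_pow,
      inv_pow, Real.sq_sqrt (h.pos n).le]
    have := h.pos 0
    have : μ 0 ≤ μ n := h.strictMono.monotone n.zero_le
    gcongr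
  obtain ⟨f, hf⟩ : ∃ f : H, ∀ n, inner ℂ (ψ n) f = (√(μ n) : ℂ)⁻¹ * inner ℂ (ψ n) x := by
    refine ⟨h.basis.repr.symm ⟨_, hc⟩, fun n => ?_⟩
    rw [← congrFun h.coe_basis n, ← HilbertBasis.repr_apply_apply,
      LinearIsometryEquiv.apply_symm_apply, h.coe_basis]
  have hf' : ∀ n, (√(μ n) : ℂ) * inner ℂ (ψ n) f = inner ℂ (ψ n) x := fun n => by
    rw [hf, mul_inv_cancel_left₀ (h.sqrt_ne_zero n)]
  refine ⟨⟨f, (mem_diagOp_domain _ _ f).2 ?_⟩, h.ext_inner fun n => ?_⟩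
  · simpa only [hf'] using hx
  · rw [h.inner_sqrtOp, hf']

/-- The algebraic inverse is symmetric and everywhere defined, hence bounded by Hellinger–Toeplitz.
-/
theorem exists_isSymmInverse (h : IsUnperturbed A μ ψ) :
    ∃ K : H →L[ℂ] H, IsSymmInverse h.sqrtOp K := by
  let e := LinearEquiv.ofBijective h.sqrtOp.toFun ⟨h.sqrtOp_injective, h.sqrtOp_surjective⟩
  have he : ∀ x, h.sqrtOp (e.symm x) = x := e.apply_symm_apply
  have hsymm : (h.sqrtOp.domain.subtype ∘ₗ e.symm.toLinearMap).IsSymmetric := fun x y => by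
    have := h.inner_sqrtOp_left (e.symm x) (e.symm y)
    rw [he, he] at this
    exact this.symm
  exact ⟨⟨_, hsymm.continuous⟩, fun x => (e.symm x).2, he,
    fun f => congrArg Subtype.val (e.symm_apply_apply f), hsymm⟩

/-- Comparing coefficients shows `K² = A⁻¹`, which is minus the resolvent at 0 and so compact. -/
theorem isCompactOperator_inverse (h : IsUnperturbed A μ ψ) {K : H →L[ℂ] H}
    (hK : IsSymmInverse h.sqrtOp K) : IsCompactOperator (⇑K : H → H) := by
  obtain ⟨G, hG⟩ := h.exists_isResolventAt_zero
  refine isCompactOperator_of_comp_self hK.symm ?_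
  have hGK : (⇑K ∘ ⇑K : H → H) = ⇑(-G) := by
    funext x
    have hn : ∀ n x, (√(μ n) : ℂ) * inner ℂ (ψ n) (K x) = inner ℂ (ψ n) x := fun n x => by
      rw [← hK.coe_toDomain, ← h.inner_sqrtOp, hK.apply_toDomain]
    obtain ⟨y, hy, hx⟩ := hG.1 x
    refine h.ext_inner fun n => mul_left_cancel₀ (h.sqrt_ne_zero n)
      (mul_left_cancel₀ (h.sqrt_ne_zero n) ?_)
    have hAy : -A y = x := by rw [← hx, zero_smul, zero_sub]
    rw [Function.comp_apply, hn, hn, _root_.neg_apply, ← hy, ← hAy, inner_neg_right,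
      h.inner_apply, inner_neg_right, ← mul_assoc, ← Complex.ofReal_mul,
      Real.mul_self_sqrt (h.pos n).le, mul_neg]
  rw [hGK]
  exact (h.compactResolvent.2 0 G hG).neg

end IsUnperturbed

/-! ### Forms with a dominated matrix -/

theorem IsBoundedForm.isSeparatelyContinuous {S : H →ₗ.[ℂ] H} {v : SesqForm S.domain}
    (hv : IsBoundedForm S v) : IsSeparatelyContinuous S v := by
  obtain ⟨C, hC⟩ := hv
  exact ⟨fun f => ⟨C * ‖S f‖, hC f⟩,
    fun g => ⟨C * ‖S g‖, fun f => (hC f g).trans_eq (by ring)⟩⟩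

theorem IsBoundedForm.sub {S : H →ₗ.[ℂ] H} {v w : SesqForm S.domain}
    (hv : IsBoundedForm S v) (hw : IsBoundedForm S w) : IsBoundedForm S (v - w) := by
  obtain ⟨B, hB⟩ := hv
  obtain ⟨C, hC⟩ := hw
  refine ⟨B + C, fun f g => ?_⟩
  rw [LinearMap.sub_apply, LinearMap.sub_apply]
  linarith [norm_sub_le (v f g) (w f g), hB f g, hC f g]

namespace IsUnperturbed

variable [CompleteSpace H] {A : H →ₗ.[ℂ] H} {μ : ℕ → ℝ} {ψ : ℕ → H} {ω : ℕ → ℝ}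

/-- Cauchy–Schwarz and Bessel. Keeping the finite set `s` in the constant allows small constants
away from a finite set of indices. -/
theorem sum_weight_sq_le (h : IsUnperturbed A μ ψ) (s : Finset ℕ) (f : h.sqrtOp.domain) :
    (∑ j ∈ s, ω j * ‖(inner ℂ (ψ j) (f : H) : ℂ)‖) ^ 2 ≤
      (∑ j ∈ s, ω j ^ 2 / μ j) * ‖h.sqrtOp f‖ ^ 2 := by
  have h1 : ∀ j, ω j * ‖(inner ℂ (ψ j) (f : H) : ℂ)‖ =
      ω j / √(μ j) * ‖(inner ℂ (ψ j) (h.sqrtOp f) : ℂ)‖ := fun j => by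
    have := Real.sqrt_ne_zero'.2 (h.pos j)
    rw [h.inner_sqrtOp, norm_mul, Complex.norm_real, Real.norm_of_nonneg (Real.sqrt_nonneg _)]
    field_simp
  have h2 : ∀ j, ω j ^ 2 / μ j = (ω j / √(μ j)) ^ 2 := fun j => by
    rw [div_pow, Real.sq_sqrt (h.pos j).le]
  simp only [h1, h2]
  refine (Finset.sum_mul_sq_le_sq_mul_sq _ _ _).trans ?_
  gcongr
  exact h.orthonormal.sum_inner_products_le _

theorem sum_weight_le (h : IsUnperturbed A μ ψ) (hsum : Summable fun j => ω j ^ 2 / μ j)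
    (s : Finset ℕ) (f : h.sqrtOp.domain) :
    ∑ j ∈ s, ω j * ‖(inner ℂ (ψ j) (f : H) : ℂ)‖ ≤
      √(∑' j, ω j ^ 2 / μ j) * ‖h.sqrtOp f‖ := by
  refine le_of_sq_le_sq ((h.sum_weight_sq_le s f).trans ?_) (by positivity)
  have h0 : ∀ j, 0 ≤ ω j ^ 2 / μ j := fun j => div_nonneg (sq_nonneg _) (h.pos j).le
  rw [mul_pow, Real.sq_sqrt (tsum_nonneg h0)]
  gcongr
  exact hsum.sum_le_tsum s fun j _ => h0 j

theorem summable_weight (h : IsUnperturbed A μ ψ) (hω : ∀ j, 0 ≤ ω j)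
    (hsum : Summable fun j => ω j ^ 2 / μ j) (f : h.sqrtOp.domain) :
    Summable fun j => ω j * ‖(inner ℂ (ψ j) (f : H) : ℂ)‖ :=
  summable_of_sum_le (fun j => mul_nonneg (hω j) (norm_nonneg _))
    fun s => h.sum_weight_le hsum s f

theorem tsum_weight_le (h : IsUnperturbed A μ ψ) (hω : ∀ j, 0 ≤ ω j)
    (hsum : Summable fun j => ω j ^ 2 / μ j) (f : h.sqrtOp.domain) :
    ∑' j, ω j * ‖(inner ℂ (ψ j) (f : H) : ℂ)‖ ≤ √(∑' j, ω j ^ 2 / μ j) * ‖h.sqrtOp f‖ :=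
  (h.summable_weight hω hsum f).tsum_le_of_sum_le fun s => h.sum_weight_le hsum s f

/-- The weighted coefficient sum has relative bound zero with respect to the square root. -/
theorem exists_tsum_weight_sq_le (h : IsUnperturbed A μ ψ) (hω : ∀ j, 0 ≤ ω j)
    (hsum : Summable fun j => ω j ^ 2 / μ j) {ε : ℝ} (hε : 0 < ε) :
    ∃ C : ℝ, 0 < C ∧ ∀ f : h.sqrtOp.domain,
      (∑' j, ω j * ‖(inner ℂ (ψ j) (f : H) : ℂ)‖) ^ 2 ≤
        ε * (‖h.sqrtOp f‖ ^ 2 + C * ‖(f : H)‖ ^ 2) := by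
  obtain ⟨F, hF⟩ := summable_iff_vanishing_norm.1 hsum (ε / 2) (by positivity)
  set B := ∑ j ∈ F, ω j with hB
  have hB0 : 0 ≤ B := Finset.sum_nonneg fun j _ => hω j
  -- Indices in `F` contribute at most `B ‖f‖`, the others at most `√(ε / 2) ‖S f‖`; squaring with
  -- `(a + b)² ≤ 2 (a² + b²)` gives `2 B² / ε`. The `+ 1` only ensures positivity.
  refine ⟨2 * B ^ 2 / ε + 1, by positivity, fun f => ?_⟩
  have key : ∑' j, ω j * ‖(inner ℂ (ψ j) (f : H) : ℂ)‖ ≤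
      B * ‖(f : H)‖ + √(ε / 2) * ‖h.sqrtOp f‖ := by
    refine (h.summable_weight hω hsum f).tsum_le_of_sum_le fun s => ?_
    rw [← Finset.sum_inter_add_sum_sdiff s F]
    refine add_le_add ?_ (le_of_sq_le_sq ((h.sum_weight_sq_le _ f).trans ?_) (by positivity))
    · rw [hB, Finset.sum_mul]
      calc _ ≤ ∑ j ∈ s ∩ F, ω j * ‖(f : H)‖ := Finset.sum_le_sum fun j _ => by
            refine mul_le_mul_of_nonneg_left ?_ (hω j)
            simpa [h.norm_eq_one] using norm_inner_le_norm (𝕜 := ℂ) (ψ j) (f : H)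
        _ ≤ _ := Finset.sum_le_sum_of_subset_of_nonneg Finset.inter_subset_right
            fun j _ _ => mul_nonneg (hω j) (norm_nonneg _)
    · rw [mul_pow, Real.sq_sqrt (by positivity)]
      gcongr
      exact (le_abs_self _).trans (hF _ Finset.sdiff_disjoint).le
  have h0 : 0 ≤ ∑' j, ω j * ‖(inner ℂ (ψ j) (f : H) : ℂ)‖ :=
    tsum_nonneg fun j => mul_nonneg (hω j) (norm_nonneg _)
  have h1 := pow_le_pow_left₀ h0 key 2
  have h2 := add_sq_le (a := B * ‖(f : H)‖) (b := √(ε / 2) * ‖h.sqrtOp f‖)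
  rw [mul_pow, mul_pow, Real.sq_sqrt (by positivity)] at h2
  have h3 : ε * (‖h.sqrtOp f‖ ^ 2 + (2 * B ^ 2 / ε + 1) * ‖(f : H)‖ ^ 2) =
      ε * ‖h.sqrtOp f‖ ^ 2 + 2 * B ^ 2 * ‖(f : H)‖ ^ 2 + ε * ‖(f : H)‖ ^ 2 := by
    field_simp
    ring
  rw [h3]
  nlinarith [mul_nonneg hε.le (sq_nonneg ‖(f : H)‖)]

theorem sqrtOp_vec (h : IsUnperturbed A μ ψ) (j : ℕ) :
    h.sqrtOp (h.vec j) = (√(μ j) : ℂ) • ψ j := by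
  refine h.ext_inner fun n => ?_
  rw [h.inner_sqrtOp, inner_smul_right]
  change _ * inner ℂ (ψ n) (ψ j) = _
  rcases eq_or_ne n j with rfl | hn
  · rfl
  · have : inner ℂ (ψ n) (ψ j) = 0 := h.orthonormal.2 hn
    rw [this, mul_zero, mul_zero]

/-- A continuous functional on the form domain is controlled by its values on the eigenvectors. -/
theorem norm_apply_le_tsum_weight (h : IsUnperturbed A μ ψ) (hω : ∀ j, 0 ≤ ω j)
    (hsum : Summable fun j => ω j ^ 2 / μ j) {σ : ℂ →+* ℂ} [RingHomIsometric σ]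
    (φ : h.sqrtOp.domain →ₛₗ[σ] ℂ) (hφ : ∃ C : ℝ, ∀ f, ‖φ f‖ ≤ C * ‖h.sqrtOp f‖) {c : ℝ}
    (hc : ∀ j, ‖φ (h.vec j)‖ ≤ c * ω j) (f : h.sqrtOp.domain) :
    ‖φ f‖ ≤ c * ∑' j, ω j * ‖(inner ℂ (ψ j) (f : H) : ℂ)‖ := by
  obtain ⟨K, hK⟩ := h.exists_isSymmInverse
  obtain ⟨C, hC⟩ := hφ
  let Φ : H →SL[σ] ℂ := (φ ∘ₛₗ hK.toDomain).mkContinuous C fun x => by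
    simpa using hC (hK.toDomain x)
  -- The expansion of `S f` in `H` is the image under `S` of the expansion of `f`, so `Φ = φ ∘ K`
  -- turns it into `φ f = ∑ σ(f_j) φ(ψ_j)`.
  have h1 := (h.basis.hasSum_repr (h.sqrtOp f)).map Φ Φ.continuous
  have h2 : ∀ j, (Φ ∘ fun i => h.basis.repr (h.sqrtOp f) i • h.basis i) j =
      σ (inner ℂ (ψ j) (f : H)) * φ (h.vec j) := fun j => by
    have h3 : (inner ℂ (ψ j) (h.sqrtOp f) : ℂ) • ψ j =
        h.sqrtOp ((inner ℂ (ψ j) (f : H) : ℂ) • h.vec j) := by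
      rw [h.inner_sqrtOp, LinearPMap.map_smul, h.sqrtOp_vec, smul_smul, mul_comm]
    rw [Function.comp_apply, HilbertBasis.repr_apply_apply, h.coe_basis, h3]
    change φ (hK.toDomain _) = _
    rw [hK.toDomain_apply, map_smulₛₗ, smul_eq_mul]
  have h3 : Φ (h.sqrtOp f) = φ f := congrArg φ (hK.toDomain_apply f)
  rw [funext h2, h3] at h1
  refine h1.norm_le_of_bounded ((h.summable_weight hω hsum f).hasSum.mul_left c) fun j => ?_
  rw [norm_mul, RingHomIsometric.norm_map]
  calc _ ≤ ‖(inner ℂ (ψ j) (f : H) : ℂ)‖ * (c * ω j) := by gcongr; exact hc j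
    _ = _ := by ring

/-- The functional estimate is used twice: on the antilinear `v(ψ_j, ·)`, where it yields `ω_j
W(g)`, and then on the linear `v(·, g)` with constant `c = W(g)`. No joint continuity enters. -/
theorem norm_form_le (h : IsUnperturbed A μ ψ) (hω : ∀ j, 0 ≤ ω j)
    (hsum : Summable fun j => ω j ^ 2 / μ j) {v : SesqForm h.sqrtOp.domain}
    (hv : IsSeparatelyContinuous h.sqrtOp v)
    (hvω : ∀ j k, ‖v (h.vec j) (h.vec k)‖ ≤ ω j * ω k) (f g : h.sqrtOp.domain) :
    ‖v f g‖ ≤ (∑' j, ω j * ‖(inner ℂ (ψ j) (g : H) : ℂ)‖) *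
      ∑' j, ω j * ‖(inner ℂ (ψ j) (f : H) : ℂ)‖ :=
  h.norm_apply_le_tsum_weight hω hsum (v.flip g) (hv.2 g) (fun j =>
    (h.norm_apply_le_tsum_weight hω hsum (v (h.vec j)) (hv.1 _) (hvω j) g).trans_eq
      (mul_comm _ _)) f

theorem isBoundedForm (h : IsUnperturbed A μ ψ) (hω : ∀ j, 0 ≤ ω j)
    (hsum : Summable fun j => ω j ^ 2 / μ j) {v : SesqForm h.sqrtOp.domain}
    (hv : ∀ f g, ‖v f g‖ ≤ (∑' j, ω j * ‖(inner ℂ (ψ j) (g : H) : ℂ)‖) *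
      ∑' j, ω j * ‖(inner ℂ (ψ j) (f : H) : ℂ)‖) :
    IsBoundedForm h.sqrtOp v := by
  refine ⟨√(∑' j, ω j ^ 2 / μ j) * √(∑' j, ω j ^ 2 / μ j), fun f g => (hv f g).trans ?_⟩
  calc _ ≤ (√(∑' j, ω j ^ 2 / μ j) * ‖h.sqrtOp g‖) * (√(∑' j, ω j ^ 2 / μ j) * ‖h.sqrtOp f‖) :=
        mul_le_mul (h.tsum_weight_le hω hsum g) (h.tsum_weight_le hω hsum f)
          (tsum_nonneg fun j => mul_nonneg (hω j) (norm_nonneg _)) (by positivity)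
    _ = _ := by ring

/-- A bounded form is determined by its matrix. -/
theorem form_ext (h : IsUnperturbed A μ ψ) {v w : SesqForm h.sqrtOp.domain}
    (hv : IsBoundedForm h.sqrtOp v) (hw : IsBoundedForm h.sqrtOp w)
    (hvw : ∀ j k, v (h.vec j) (h.vec k) = w (h.vec j) (h.vec k)) : v = w := by
  rw [← sub_eq_zero]
  ext f g
  -- The difference has zero matrix, so it is dominated with weights 0.
  have := h.norm_form_le (ω := 0) (fun _ => le_rfl) (by simp [summable_zero])
    (hv.sub hw).isSeparatelyContinuous (fun j k => by simp [hvw]) f g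
  simpa using this

/-- The terms are dominated by the product of two summable sequences, whose double sum factors. -/
theorem summable_matrix (h : IsUnperturbed A μ ψ) (hω : ∀ j, 0 ≤ ω j)
    (hsum : Summable fun j => ω j ^ 2 / μ j) {m : ℕ → ℕ → ℂ}
    (hm : ∀ j k, ‖m j k‖ ≤ ω j * ω k) (f g : h.sqrtOp.domain) :
    (Summable fun p : ℕ × ℕ => inner ℂ (ψ p.1) (f : H) *
      (starRingEnd ℂ (inner ℂ (ψ p.2) (g : H)) * m p.1 p.2)) ∧
    ‖∑' p : ℕ × ℕ, inner ℂ (ψ p.1) (f : H) *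
      (starRingEnd ℂ (inner ℂ (ψ p.2) (g : H)) * m p.1 p.2)‖ ≤
      (∑' j, ω j * ‖(inner ℂ (ψ j) (g : H) : ℂ)‖) *
        ∑' j, ω j * ‖(inner ℂ (ψ j) (f : H) : ℂ)‖ := by
  have hf := h.summable_weight hω hsum f
  have hg := h.summable_weight hω hsum g
  have h0 : ∀ (u : H) j, 0 ≤ ω j * ‖(inner ℂ (ψ j) u : ℂ)‖ :=
    fun u j => mul_nonneg (hω j) (norm_nonneg _)
  have hfg := hf.mul_of_nonneg hg (h0 f) (h0 g)
  have hle : ∀ p : ℕ × ℕ, ‖(inner ℂ (ψ p.1) (f : H) : ℂ) *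
      (starRingEnd ℂ (inner ℂ (ψ p.2) (g : H)) * m p.1 p.2)‖ ≤
      ω p.1 * ‖(inner ℂ (ψ p.1) (f : H) : ℂ)‖ * (ω p.2 * ‖(inner ℂ (ψ p.2) (g : H) : ℂ)‖) := by
    intro p
    rw [norm_mul, norm_mul, RCLike.norm_conj]
    calc _ ≤ ‖(inner ℂ (ψ p.1) (f : H) : ℂ)‖ *
          (‖(inner ℂ (ψ p.2) (g : H) : ℂ)‖ * (ω p.1 * ω p.2)) := by gcongr; exact hm _ _
      _ = _ := by ring
  refine ⟨hfg.of_norm_bounded hle, (tsum_of_norm_bounded hfg.hasSum hle).trans_eq ?_⟩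
  rw [mul_comm, hf.tsum_mul_tsum hg hfg]

/-- A matrix dominated by `ω j * ω k` is the matrix of a bounded form. -/
theorem exists_isBoundedForm (h : IsUnperturbed A μ ψ) (hω : ∀ j, 0 ≤ ω j)
    (hsum : Summable fun j => ω j ^ 2 / μ j) {m : ℕ → ℕ → ℂ}
    (hm : ∀ j k, ‖m j k‖ ≤ ω j * ω k) :
    ∃ v : SesqForm h.sqrtOp.domain, IsBoundedForm h.sqrtOp v ∧
      ∀ j k, v (h.vec j) (h.vec k) = m j k := by
  have hs := fun f g => (h.summable_matrix hω hsum hm f g).1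
  let v : SesqForm h.sqrtOp.domain := LinearMap.mk₂'ₛₗ (RingHom.id ℂ) (starRingEnd ℂ)
    (fun f g => ∑' p : ℕ × ℕ, inner ℂ (ψ p.1) (f : H) *
      (starRingEnd ℂ (inner ℂ (ψ p.2) (g : H)) * m p.1 p.2))
    (fun f f' g => by
      rw [← (hs f g).tsum_add (hs f' g)]
      refine tsum_congr fun p => ?_
      rw [Submodule.coe_add, inner_add_right, add_mul])
    (fun c f g => by
      rw [RingHom.id_apply, smul_eq_mul, ← tsum_mul_left]
      refine tsum_congr fun p => ?_
      rw [Submodule.coe_smul, inner_smul_right, mul_assoc])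
    (fun f g g' => by
      rw [← (hs f g).tsum_add (hs f g')]
      refine tsum_congr fun p => ?_
      rw [Submodule.coe_add, inner_add_right, map_add]
      ring)
    (fun c f g => by
      rw [smul_eq_mul, ← tsum_mul_left]
      refine tsum_congr fun p => ?_
      rw [Submodule.coe_smul, inner_smul_right, map_mul]
      ring)
  refine ⟨v, h.isBoundedForm hω hsum fun f g => (h.summable_matrix hω hsum hm f g).2,
    fun j k => ?_⟩
  have hne : ∀ i l, i ≠ l → inner ℂ (ψ i) (ψ l) = 0 := fun i l hil => h.orthonormal.2 hil
  change ∑' p : ℕ × ℕ, inner ℂ (ψ p.1) (ψ j) *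
      (starRingEnd ℂ (inner ℂ (ψ p.2) (ψ k)) * m p.1 p.2) = _
  rw [tsum_eq_single (j, k)]
  · simp [h.norm_eq_one]
  · rintro ⟨i, l⟩ hil
    by_cases hi : i = j
    · have hl : l ≠ k := fun hl => hil (by rw [hi, hl])
      simp [hne l k hl]
    · simp [hne i j hi]

end IsUnperturbed

end FormPert

end

/-! ### Small perturbations of `a` and extension from the span -/

open FormPert in
theorem proposition3p1 {H : Type*} [NormedAddCommGroup H] [InnerProductSpace ℂ H]
    [CompleteSpace H] [TopologicalSpace.SeparableSpace H]
    (A : H →ₗ.[ℂ] H) (μ : ℕ → ℝ) (ψ : ℕ → H) (hA : IsUnperturbed A μ ψ)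
    (ω : ℕ → ℝ) (hω : ∀ j, 0 ≤ ω j) (hsum : Summable fun j => ω j ^ 2 / μ j) :
    (∀ v : SesqForm hA.sqrtOp.domain, IsSeparatelyContinuous hA.sqrtOp v →
      (∀ j k, ‖v (hA.vec j) (hA.vec k)‖ ≤ ω j * ω k) →
        IsBoundedForm hA.sqrtOp v ∧
        (∀ ε : ℝ, 0 < ε → ∃ C : ℝ, 0 < C ∧ ∀ f : hA.sqrtOp.domain,
          ‖v f f‖ ≤ ε * (‖hA.sqrtOp f‖ ^ 2 + C * ‖(f : H)‖ ^ 2)) ∧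
        IsClosedForm (hA.form + v) ∧
        IsSectorialForm (hA.form + v) ∧
        ∃ T : H →ₗ.[ℂ] H, IsAssociated (hA.form + v) T ∧ IsMSectorial T ∧
          HasCompactResolvent T ∧
          ∀ T' : H →ₗ.[ℂ] H, IsMSectorial T' → Represents (hA.form + v) T' → T' = T) ∧
    (∀ v₀ : SesqForm (Submodule.span ℂ (Set.range ψ)),
      (∀ j k, ‖v₀ (spanVec ψ j) (spanVec ψ k)‖ ≤ ω j * ω k) →
        ∃! v : SesqForm hA.sqrtOp.domain, IsBoundedForm hA.sqrtOp v ∧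
          ∀ j k, v (hA.vec j) (hA.vec k) = v₀ (spanVec ψ j) (spanVec ψ k)) := by
  refine ⟨fun v hv hvω => ?_, fun v₀ hv₀ => ?_⟩
  · have hle := hA.norm_form_le hω hsum hv hvω
    have hb := hA.isBoundedForm hω hsum hle
    have hε : ∀ ε : ℝ, 0 < ε → ∃ C : ℝ, 0 < C ∧ ∀ f : hA.sqrtOp.domain,
        ‖v f f‖ ≤ ε * (‖hA.sqrtOp f‖ ^ 2 + C * ‖(f : H)‖ ^ 2) := fun ε hε => by
      obtain ⟨C, hC0, hC⟩ := hA.exists_tsum_weight_sq_le hω hsum hε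
      exact ⟨C, hC0, fun f => (hle f f).trans (by rw [← sq]; exact hC f)⟩
    -- Coercivity of `a + v` needs a relative bound below 1; the value `1 / 2` is the one fixed in
    -- the form lemmas.
    obtain ⟨C, hC0, hC⟩ := hε (1 / 2) (by norm_num)
    obtain ⟨K, hK⟩ := hA.exists_isSymmInverse
    exact ⟨hb, hε, isClosedForm_gramForm_add hK hb hC, isSectorialForm_gramForm_add hC0.le hC,
      exists_isAssociated_isMSectorial hK (hA.isCompactOperator_inverse hK) hb hC0.le hC⟩
  -- Only the matrix of `v₀` matters, since a sesquilinear form on the span is determined by it.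
  · obtain ⟨v, hv, hvm⟩ := hA.exists_isBoundedForm hω hsum hv₀
    exact ⟨v, ⟨hv, hvm⟩, fun w hw => hA.form_ext hw.1 hv fun j k => by rw [hw.2, hvm]⟩
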